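/- **Theorem 1.1.** Let $\Gamma=(V,E,\mathrm{wt})$ be a finite weighted directed multigraph (loops and parallel edges allowed) with edge weights in a field $K$ of characteristic $0$ (for instance real weights, or indeterminates over $\mathbb{Q}$), and let $k\ge 1$. For a vertex $v$, an arborescence rooted at $v$ is a spanning tree all of whose edges are directed towards $v$; its weight is the product of its edge weights, and $A_v(\Gamma)$ is the sum of the weights of all arborescences rooted at $v$. Let $E_s(w)$ be the set of edges coming out of $w$. Choose for each edge $e$ a voltage $\sigma_e\in S_k$ independently and uniformly at random, and let $\tilde\Gamma$ be the resulting random $k$-fold cover: its vertex set is $V\times\{1,\dots,k\}$, and each edge $e$ from $v$ to $w$ of $\Gamma$ lifts to the $k$ edges from $(v,x)$ to $(w,\sigma_e(x))$, $1\le x\le k$, each of weight $\mathrm{wt}(e)$. Then: 1. For every vertex $v$ with $A_v(\Gamma)\neq 0$ and every lift $\tilde v=(v,x)$ of $v$, the arborescence ratio $R(\tilde\Gamma)=A_{\tilde v}(\tilde\Gamma)/A_v(\Gamma)$ has expected value $$\mathbb{E}[R(\tilde\Gamma)]=\frac1k\prod_{w\in V}\Bigl(\sum_{\alpha\in E_s(w)}\mathrm{wt}(\alpha)\Bigr)^{k-1}.$$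 2. Let $D$ and $\mathcal{A}$ be the matrices with rows and columns indexed by the pairs $(v,t)$ with $v\in V$, $2\le t\le k$, where $D$ is diagonal with entries $D[(v,t),(v,t)]=\sum_{\alpha\in E_s(v)}\mathrm{wt}(\alpha)$, and $\mathcal{A}[(v,t),(w,r)]$ is the total weight of the edges of $\tilde\Gamma$ from $(v,t)$ to $(w,r)$ minus the total weight of those from $(v,t)$ to $(w,1)$. Let $\mathcal{L}(\Gamma)=D-\mathcal{A}$ be the voltage Laplacian. Then for every choice of the voltages, every $v$ with $A_v(\Gamma)\ne 0$ and every lift $\tilde v$ of $v$, $$\frac{A_{\tilde v}(\tilde\Gamma)}{A_v(\Gamma)}=\frac1k\det\mathcal{L}(\Gamma);$$ in particular the ratio $R(\tilde\Gamma)$ depends neither on $v$ nor on $\tilde v$. 3. $\mathbb{E}[\det(D-\mathcal{A})]=\det D$. -/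

import Mathlib

open scoped BigOperators

/-- A finite weighted directed multigraph with vertex set `V`, edge set `E` and edge weights in
`K`.  Loops and parallel edges are allowed; the edge `e` goes from `src e` to `tgt e`. -/
structure WeightedDigraph (V E K : Type*) where
  src : E → V
  tgt : E → V
  wt : E → K

namespace WeightedDigraph

/-- There is an edge of `T` going from `u` to `w`. -/
def Step {V E K : Type*} (Γ : WeightedDigraph V E K) (T : Finset E) (u w : V) : Prop :=
  ∃ e ∈ T, Γ.src e = u ∧ Γ.tgt e = w

/-- The edge set `T` is an arborescence rooted at `v`, i.e. a spanning tree all of whose edges are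
directed towards `v`: every vertex other than `v` is the source of exactly one edge of `T`, the
root `v` is the source of none, and from every vertex one reaches `v` along edges of `T`. -/
structure IsArborescence {V E K : Type*} (Γ : WeightedDigraph V E K) (v : V) (T : Finset E) :
    Prop where
  root : ∀ e ∈ T, Γ.src e ≠ v
  existsUnique_out : ∀ u, u ≠ v → ∃! e, e ∈ T ∧ Γ.src e = u
  reach : ∀ u, Relation.ReflTransGen (Γ.Step T) u v

open Classical in
/-- `A_v(Γ)`: the sum, over all arborescences rooted at `v`, of the product of the edge weights. -/
noncomputable def arborescenceSum {V E K : Type*} [Fintype E] [Field K]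
    (Γ : WeightedDigraph V E K) (v : V) : K :=
  ∑ T : Finset E with Γ.IsArborescence v T, ∏ e ∈ T, Γ.wt e

/-- The total weight of the edges coming out of `w`. -/
def outWeight {V E K : Type*} [DecidableEq V] [Fintype E] [Field K]
    (Γ : WeightedDigraph V E K) (w : V) : K :=
  ∑ e : E with Γ.src e = w, Γ.wt e

/-- The total weight of the edges going from `u` to `w`. -/
def edgeWeight {V E K : Type*} [DecidableEq V] [Fintype E] [Field K]
    (Γ : WeightedDigraph V E K) (u w : V) : K :=
  ∑ e : E with Γ.src e = u ∧ Γ.tgt e = w, Γ.wt e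

/-- The `k`-fold cover of `Γ` given by the permutation voltages `σ`: the edge `e` lifts to the
edges `(e, x)` from `(src e, x)` to `(tgt e, σ e x)`, with the weight of `e`. -/
def cover {V E K : Type*} {k : ℕ} (Γ : WeightedDigraph V E K) (σ : E → Equiv.Perm (Fin k)) :
    WeightedDigraph (V × Fin k) (E × Fin k) K where
  src p := (Γ.src p.1, p.2)
  tgt p := (Γ.tgt p.1, σ p.1 p.2)
  wt p := Γ.wt p.1

/-- The arborescence ratio `A_ṽ(Γ̃) / A_v(Γ)` for the lift `ṽ = (v, x)` of `v`. -/
noncomputable def arborescenceRatio {V E K : Type*} [Fintype E] [Field K] {k : ℕ}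
    (Γ : WeightedDigraph V E K) (σ : E → Equiv.Perm (Fin k)) (v : V) (x : Fin k) : K :=
  (Γ.cover σ).arborescenceSum (v, x) / Γ.arborescenceSum v

/-- In the cover, the total weight out of `(v, x)` is the total weight out of `v` in `Γ`. -/
theorem outWeight_cover {V E K : Type*} [DecidableEq V] [Fintype E] [Field K] {k : ℕ}
    (Γ : WeightedDigraph V E K) (σ : E → Equiv.Perm (Fin k)) (v : V) (x : Fin k) :
    (Γ.cover σ).outWeight (v, x) = Γ.outWeight v := by
  simp only [outWeight, cover, Finset.sum_filter, Fintype.sum_prod_type, Prod.mk.injEq]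
  refine Finset.sum_congr rfl fun e _ => ?_
  by_cases h : Γ.src e = v <;> simp [h]

/-- The diagonal matrix `D`, indexed by the lifts `(v, t)` with `t` not the distinguished sheet
`0`, whose entry at `(v, t)` is the total weight out of `(v, t)` in the cover; by
`outWeight_cover` this is the total weight out of `v` in `Γ`, whatever the voltages. -/
def voltageDegree {V E K : Type*} [DecidableEq V] [Fintype E] [Field K]
    (Γ : WeightedDigraph V E K) (k : ℕ) [NeZero k] :
    Matrix (V × {t : Fin k // t ≠ 0}) (V × {t : Fin k // t ≠ 0}) K :=
  Matrix.diagonal fun p => Γ.outWeight p.1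

/-- The matrix `𝓐`, indexed by the lifts `(v, t)` with `t ≠ 0`: the entry at `(v, t), (w, r)` is
the weight of the edges of the cover from `(v, t)` to `(w, r)` minus the weight of those from
`(v, t)` to `(w, 0)`. -/
def voltageAdjacency {V E K : Type*} [DecidableEq V] [Fintype E] [Field K] {k : ℕ} [NeZero k]
    (Γ : WeightedDigraph V E K) (σ : E → Equiv.Perm (Fin k)) :
    Matrix (V × {t : Fin k // t ≠ 0}) (V × {t : Fin k // t ≠ 0}) K :=
  Matrix.of fun p q =>
    (Γ.cover σ).edgeWeight (p.1, p.2.1) (q.1, q.2.1) - (Γ.cover σ).edgeWeight (p.1, p.2.1) (q.1, 0)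

/-- The voltage Laplacian `𝓛(Γ) = D - 𝓐`. -/
def voltageLaplacian {V E K : Type*} [DecidableEq V] [Fintype E] [Field K] {k : ℕ} [NeZero k]
    (Γ : WeightedDigraph V E K) (σ : E → Equiv.Perm (Fin k)) :
    Matrix (V × {t : Fin k // t ≠ 0}) (V × {t : Fin k // t ≠ 0}) K :=
  Γ.voltageDegree k - Γ.voltageAdjacency σ

/-- The expected value of `f σ` when the voltages `σ e`, `e : E`, are chosen independently and
uniformly at random in the symmetric group on `k` letters, i.e. when `σ` is uniformly distributed
on the finite product `E → Equiv.Perm (Fin k)`: the average of `f` over this product. -/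
noncomputable def voltageExpectation {E K : Type*} [Fintype E] [DecidableEq E] [Field K]
    [CharZero K] {k : ℕ} (f : (E → Equiv.Perm (Fin k)) → K) : K :=
  𝔼 σ : E → Equiv.Perm (Fin k), f σ

end WeightedDigraph

/-!
Arborescence sums are principal cofactors of the Laplacian `L` (`det_laplacian_updateRow`). To see
this, expand the cofactor along the rows into choices of one outgoing edge at every vertex other
than the root; the determinant of such a choice is `1` if it leads to the root from everywhere and
`0` if it has a cycle (`det_one_sub_transitionMatrix`).

The Laplacian of a cover preserves the functions whose sum over every fibre is zero, because
voltages are permutations; it acts there by the voltage Laplacian, and on the quotient by the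
Laplacian of the base. A cofactor of the cover does not respect this subspace, as it singles out one
point of a fibre. But the rows of the Laplacian sum to zero, so that the unit vector in the
replaced row may be traded for the average over the fibre (`det_updateRow_eq_of_sum_eq`), and then
the determinant factors (`det_eq_mul_of_fiber_sum`, `arborescenceSum_cover`).

For the expectation, expand the determinant of the voltage Laplacian along its rows, each row using
either its diagonal entry or an edge. A term in which an edge `e` is used averages to zero over the
choice of `σ e` alone: if two rows use `e`, then composing `σ e` with a transposition changes the
sign (`sum_expansionTerm_of_pair`), and if one row does, then that row has mean zero
(`sum_expansionTerm_of_unique`). Only the product of the diagonal entries remains. In other words,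
no exterior power of the standard representation of the symmetric group, of positive degree, has
an invariant vector.
-/

namespace WeightedDigraph

/-! ### The determinant of a functional graph -/

/-- The transition matrix of the partial function `f`: row `u` is the indicator of `f u`, and is
zero where `f` is undefined. -/
def transitionMatrix (K : Type*) {V : Type*} [DecidableEq V] [Field K] (f : V → Option V) :
    Matrix V V K :=
  Matrix.of fun u w => if f u = some w then 1 else 0

theorem transitionMatrix_mulVec_apply {K V : Type*} [Fintype V] [DecidableEq V] [Field K]
    (f : V → Option V) (x : V → K) (u : V) :
    (transitionMatrix K f).mulVec x u = (f u).elim 0 x := by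
  rw [Matrix.mulVec, dotProduct]
  rcases h : f u with _ | w <;> simp [transitionMatrix, h]

/-- If every vertex is led to the only terminal vertex `v`, then high powers of the transition
matrix vanish. -/
theorem isNilpotent_transitionMatrix {K V : Type*} [Fintype V] [DecidableEq V] [Field K]
    (f : V → Option V) (v : V) (hv : f v = none)
    (h : ∀ u, Relation.ReflTransGen (fun a b => f a = some b) u v) :
    IsNilpotent (transitionMatrix K f) := by
  have key : ∀ u, ∃ n : ℕ, ∀ m, n ≤ m → ∀ x : V → K,
      ((transitionMatrix K f) ^ m).mulVec x u = 0 := by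
    intro u
    induction h u using Relation.ReflTransGen.head_induction_on with
    | refl =>
      refine ⟨1, fun m hm x => ?_⟩
      obtain ⟨m, rfl⟩ := Nat.exists_eq_add_of_le' hm
      rw [pow_succ', ← Matrix.mulVec_mulVec, transitionMatrix_mulVec_apply, hv]
      rfl
    | head hab _ ih =>
      obtain ⟨n, hn⟩ := ih
      refine ⟨n + 1, fun m hm x => ?_⟩
      obtain ⟨m, rfl⟩ := Nat.exists_eq_add_of_le' (le_trans (Nat.le_add_left 1 n) hm)
      rw [pow_succ', ← Matrix.mulVec_mulVec, transitionMatrix_mulVec_apply, hab]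
      exact hn m (by omega) x
  choose n hn using key
  refine ⟨Finset.univ.sup n, ?_⟩
  ext u w
  have := hn u _ (Finset.le_sup (Finset.mem_univ u)) (Pi.single w 1)
  simpa using this

open Classical in
/-- The functional graph of `f`, with `v` as its only terminal vertex, is a tree directed towards
`v` when the determinant of `1 - P` is `1`; otherwise it has a cycle, and the determinant is `0`. -/
theorem det_one_sub_transitionMatrix {K V : Type*} [Fintype V] [DecidableEq V] [Field K]
    (f : V → Option V) (v : V) (hf : ∀ u, f u = none ↔ u = v) :
    (1 - transitionMatrix K f).det =
      if ∀ u, Relation.ReflTransGen (fun a b => f a = some b) u v then 1 else 0 := by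
  split_ifs with h
  · have hP := isNilpotent_transitionMatrix (K := K) f v ((hf v).2 rfl) h
    have h1 := (Matrix.isNilpotent_charpoly_sub_pow_of_isNilpotent hP).eq_zero
    have h2 := Matrix.eval_charpoly (transitionMatrix K f) 1
    rw [sub_eq_zero.1 h1] at h2
    simpa using h2.symm
  · -- The indicator of the vertices that do not reach `v` lies in the kernel.
    rw [← Matrix.exists_mulVec_eq_zero_iff]
    push Not at h
    obtain ⟨u₀, hu₀⟩ := h
    let R : V → Prop := fun u => Relation.ReflTransGen (fun a b => f a = some b) u v
    refine ⟨fun u => if R u then 0 else 1, fun h0 => ?_, ?_⟩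
    · simpa [R, hu₀] using congrFun h0 u₀
    · ext u
      rw [Matrix.sub_mulVec, Matrix.one_mulVec, Pi.sub_apply, transitionMatrix_mulVec_apply,
        Pi.zero_apply, sub_eq_zero]
      rcases hu : f u with _ | w
      · have : R u := by rw [(hf u).1 hu]
        simp [this]
      · have : R u ↔ R w := by
          refine ⟨fun hR => ?_, fun hR => Relation.ReflTransGen.head hu hR⟩
          rcases Relation.ReflTransGen.cases_head hR with rfl | ⟨c, hc, hcv⟩
          · simp [(hf u).2 rfl] at hu
          · rw [hu] at hc
            exact Option.some.inj hc ▸ hcv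
        simp [this]

/-! ### The matrix tree theorem -/

/-- The Laplacian of a weighted digraph: the diagonal matrix of total outgoing weights minus the
matrix of edge weights. Its rows, not its columns, sum to zero. -/
def laplacian {V E K : Type*} [DecidableEq V] [Fintype E] [Field K]
    (Γ : WeightedDigraph V E K) : Matrix V V K :=
  Matrix.diagonal Γ.outWeight - Matrix.of Γ.edgeWeight

theorem laplacian_row {V E K : Type*} [DecidableEq V] [Fintype E] [Field K]
    (Γ : WeightedDigraph V E K) (u : V) :
    Γ.laplacian u = ∑ e with Γ.src e = u,
      Γ.wt e • (Pi.single u 1 - Pi.single (Γ.tgt e) 1 : V → K) := by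
  ext w
  simp only [laplacian, Matrix.sub_apply, Matrix.diagonal_apply, Matrix.of_apply, outWeight,
    edgeWeight, Finset.sum_apply, Pi.smul_apply, Pi.sub_apply, smul_eq_mul, mul_sub,
    Finset.sum_sub_distrib, Pi.single_apply, ← Finset.filter_filter,
    Finset.sum_filter (p := fun e => Γ.tgt e = w)]
  congr 1
  · by_cases h : u = w <;> simp [h, eq_comm (a := w)]
  · simp [eq_comm (a := w)]

theorem laplacian_mulVec_one {V E K : Type*} [Fintype V] [DecidableEq V] [Fintype E] [Field K]
    (Γ : WeightedDigraph V E K) : Γ.laplacian.mulVec 1 = 0 := by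
  ext u
  rw [Matrix.mulVec, laplacian_row]
  simp [dotProduct, Finset.sum_apply, Finset.sum_comm (s := Finset.univ (α := V)),
    ← Finset.mul_sum]

theorem det_laplacian {V E K : Type*} [Fintype V] [DecidableEq V] [Nonempty V] [Fintype E] [Field K]
    (Γ : WeightedDigraph V E K) : Γ.laplacian.det = 0 :=
  Matrix.exists_mulVec_eq_zero_iff.1 ⟨1, one_ne_zero, Γ.laplacian_mulVec_one⟩

/-- The edge choices of a vertex in the expansion of the reduced Laplacian: the root chooses
nothing, and any other vertex chooses one of its outgoing edges. -/
def edgeChoices {V E K : Type*} [DecidableEq V] [Fintype E]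
    (Γ : WeightedDigraph V E K) (v u : V) : Finset (Option E) :=
  if u = v then {none} else ({e | Γ.src e = u} : Finset E).map .some

theorem none_mem_edgeChoices {V E K : Type*} [DecidableEq V] [Fintype E]
    {Γ : WeightedDigraph V E K} {v u : V} : none ∈ Γ.edgeChoices v u ↔ u = v := by
  unfold edgeChoices
  split_ifs with h <;> simp [h]

theorem some_mem_edgeChoices {V E K : Type*} [DecidableEq V] [Fintype E]
    {Γ : WeightedDigraph V E K} {v u : V} {e : E} :
    some e ∈ Γ.edgeChoices v u ↔ u ≠ v ∧ Γ.src e = u := by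
  unfold edgeChoices
  split_ifs with h <;> simp [h]

open Classical in
/-- An arborescence rooted at `v` is the same thing as a choice of one outgoing edge at every other
vertex such that following the chosen edges leads to `v`. -/
theorem sum_edgeChoices_eq_arborescenceSum {V E K : Type*} [Fintype V] [DecidableEq V] [Fintype E]
    [Field K] (Γ : WeightedDigraph V E K) (v : V) :
    ∑ r ∈ Fintype.piFinset (Γ.edgeChoices v) with
        ∀ u, Relation.ReflTransGen (fun a b => (r a).map Γ.tgt = some b) u v,
      ∏ u, (r u).elim 1 Γ.wt = Γ.arborescenceSum v := by
  have hsrc : ∀ r ∈ Fintype.piFinset (Γ.edgeChoices v), ∀ u e, r u = some e →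
      u ≠ v ∧ Γ.src e = u := fun r hr u e h =>
    some_mem_edgeChoices.1 (h ▸ Fintype.mem_piFinset.1 hr u)
  have hstep : ∀ r ∈ Fintype.piFinset (Γ.edgeChoices v),
      Γ.Step {e | r (Γ.src e) = some e} = fun a b => (r a).map Γ.tgt = some b := by
    intro r hr
    ext a b
    simp only [Step, Finset.mem_filter, Finset.mem_univ, true_and, Option.map_eq_some_iff]
    constructor
    · rintro ⟨e, he, rfl, h⟩
      exact ⟨e, he, h⟩
    · rintro ⟨e, he, h⟩
      have := (hsrc r hr a e he).2
      exact ⟨e, by rw [this, he], this, h⟩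
  refine Finset.sum_bij (fun r _ => ({e | r (Γ.src e) = some e} : Finset E)) ?_ ?_ ?_ ?_
  · intro r hr
    rw [Finset.mem_filter] at hr
    obtain ⟨hr, hreach⟩ := hr
    refine Finset.mem_filter.2 ⟨Finset.mem_univ _, ?_, ?_, ?_⟩
    · intro e he
      exact (hsrc r hr _ e (Finset.mem_filter.1 he).2).1
    · intro u hu
      rcases h : r u with _ | e
      · exact absurd (none_mem_edgeChoices.1 (h ▸ Fintype.mem_piFinset.1 hr u)) hu
      · have he := (hsrc r hr u e h).2
        refine ⟨e, ⟨by simp [he, h], he⟩, ?_⟩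
        rintro e' ⟨he', rfl⟩
        simpa [h, eq_comm] using he'
    · rw [hstep r hr]
      exact hreach
  · intro r hr r' hr' h
    rw [Finset.mem_filter] at hr hr'
    have aux : ∀ r ∈ Fintype.piFinset (Γ.edgeChoices v), ∀ u e,
        r u = some e ↔ Γ.src e = u ∧ e ∈ ({e | r (Γ.src e) = some e} : Finset E) := by
      intro r hr u e
      constructor
      · intro he
        have := (hsrc r hr u e he).2
        simp [this, he]
      · rintro ⟨rfl, he⟩
        simpa using he
    ext u e
    rw [aux r hr.1, aux r' hr'.1, h]
  · intro T hT
    have hT := (Finset.mem_filter.1 hT).2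
    choose g hg using fun u hu => (hT.existsUnique_out u hu).exists
    have hgu : ∀ e (he : e ∈ T), g (Γ.src e) (hT.root e he) = e := fun e he =>
      (hT.existsUnique_out _ (hT.root e he)).unique (hg _ (hT.root e he)) ⟨he, rfl⟩
    let r : V → Option E := fun u => if hu : u = v then none else some (g u hu)
    have hr : r ∈ Fintype.piFinset (Γ.edgeChoices v) := by
      rw [Fintype.mem_piFinset]
      intro u
      by_cases hu : u = v
      · simp [r, hu, none_mem_edgeChoices]
      · simp [r, hu, some_mem_edgeChoices, (hg u hu).2]
    have hrT : ({e | r (Γ.src e) = some e} : Finset E) = T := by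
      ext e
      simp only [r, Finset.mem_filter, Finset.mem_univ, true_and]
      constructor
      · intro he
        split_ifs at he with h
        exact Option.some.inj he ▸ (hg _ h).1
      · intro he
        rw [dif_neg (hT.root e he), hgu e he]
    refine ⟨r, Finset.mem_filter.2 ⟨hr, ?_⟩, hrT⟩
    rw [← hstep r hr, hrT]
    exact hT.reach
  · intro r hr
    rw [Finset.mem_filter] at hr
    rw [← Finset.prod_fiberwise _ Γ.src]
    refine Finset.prod_congr rfl fun u _ => ?_
    rcases h : r u with _ | e
    · refine (Finset.prod_eq_one fun e he => ?_).symm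
      simp only [Finset.mem_filter, Finset.mem_univ, true_and] at he
      rw [he.2, h] at he
      simp at he
    · have : ({e' ∈ ({e | r (Γ.src e) = some e} : Finset E) | Γ.src e' = u}) = {e} := by
        ext e'
        simp only [Finset.mem_filter, Finset.mem_univ, true_and, Finset.mem_singleton]
        constructor
        · rintro ⟨he, rfl⟩
          simpa [h, eq_comm] using he
        · rintro rfl
          have := (hsrc r hr.1 u e' h).2
          exact ⟨by rw [this, h], this⟩
      rw [this]
      simp

/-- **Matrix tree theorem** for weighted digraphs: the principal cofactor of the Laplacian at `v`
counts arborescences rooted at `v`. The cofactor is written as the determinant of the Laplacian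
with row `v` replaced by a unit vector. -/
theorem det_laplacian_updateRow {V E K : Type*} [Fintype V] [DecidableEq V] [Fintype E]
    [Field K] (Γ : WeightedDigraph V E K) (v : V) :
    (Γ.laplacian.updateRow v (Pi.single v 1)).det = Γ.arborescenceSum v := by
  classical
  let g : V → Option E → V → K := fun u j =>
    j.elim (Pi.single u 1) fun e => Γ.wt e • (Pi.single u 1 - Pi.single (Γ.tgt e) 1)
  have hrow : Γ.laplacian.updateRow v (Pi.single v 1) =
      fun u => ∑ j ∈ Γ.edgeChoices v u, g u j := by
    funext u
    by_cases hu : u = v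
    · subst hu
      rw [Matrix.updateRow_self]
      simp [edgeChoices, g]
    · rw [Matrix.updateRow_ne hu, laplacian_row]
      simp [edgeChoices, hu, g]
  rw [hrow, ← sum_edgeChoices_eq_arborescenceSum, Finset.sum_filter]
  refine ((Matrix.detRowAlternating (R := K) (n := V)).toMultilinearMap.map_sum_finset g
    (Γ.edgeChoices v)).trans (Finset.sum_congr rfl fun r hr => ?_)
  have hdet : (Matrix.of fun u => g u (r u)) = Matrix.of fun u w => (r u).elim 1 Γ.wt *
      (1 - transitionMatrix K fun a => (r a).map Γ.tgt) u w := by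
    ext u w
    rcases h : r u with _ | e
    · simp [g, h, transitionMatrix, Matrix.one_apply, Pi.single_apply, eq_comm]
    · simp [g, h, transitionMatrix, Matrix.one_apply, Pi.single_apply, eq_comm]
  change (Matrix.of fun u => g u (r u)).det = _
  rw [hdet, Matrix.det_mul_column, det_one_sub_transitionMatrix _ v]
  · simp
  · intro u
    rw [Option.map_eq_none_iff, ← none_mem_edgeChoices (Γ := Γ)]
    constructor
    · intro h
      exact h ▸ Fintype.mem_piFinset.1 hr u
    · intro h
      have hu := none_mem_edgeChoices.1 h
      simpa [edgeChoices, hu] using Fintype.mem_piFinset.1 hr u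

/-! ### Determinants of matrices with constant fibre sums -/

/-- When the rows of `A` sum to zero, replacing a row of `A` by `z` gives a determinant that depends
only on the sum of the entries of `z`. -/
theorem det_updateRow_eq_of_sum_eq {n K : Type*} [Fintype n] [DecidableEq n] [Field K]
    (A : Matrix n n K) (hA : A.mulVec 1 = 0) (i : n) {z z' : n → K}
    (h : ∑ j, z j = ∑ j, z' j) : (A.updateRow i z).det = (A.updateRow i z').det := by
  have h0 : (A.updateRow i (z - z')).det = 0 := by
    rw [← Matrix.exists_mulVec_eq_zero_iff]
    refine ⟨1, fun h1 => one_ne_zero (congrFun h1 i), ?_⟩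
    ext j
    by_cases hj : j = i
    · subst hj
      simp [Matrix.mulVec, dotProduct, h]
    · simpa [Matrix.mulVec, dotProduct, hj] using congrFun hA j
  have h1 := Matrix.det_updateRow_add A i (z - z') z'
  rwa [sub_add_cancel, h0, zero_add] at h1

/-- The points of `V × ι`, split into those of the distinguished sheet `o` and the others. -/
def sheetEquiv (V : Type*) {ι : Type*} [DecidableEq ι] (o : ι) :
    V ⊕ V × {t : ι // t ≠ o} ≃ V × ι where
  toFun := Sum.elim (fun v => (v, o)) fun p => (p.1, p.2.1)
  invFun p := if h : p.2 = o then .inl p.1 else .inr (p.1, ⟨p.2, h⟩)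
  left_inv := by rintro (v | ⟨v, t, ht⟩) <;> simp [*]
  right_inv := by
    rintro ⟨v, t⟩
    by_cases h : t = o <;> simp [h]

/-- If the sum of `M` over the row fibre of `v` is `N v w` in every column over `w`, then `M` maps
the functions with zero fibre sums to themselves and induces `N` on the quotient. In the basis
`e_{(w,r)} - e_{(w,o)}` of the former, `M` is given by the differences of columns below. -/
theorem det_eq_mul_of_fiber_sum {V ι K : Type*} [Fintype V] [DecidableEq V] [Fintype ι]
    [DecidableEq ι] [Field K] (o : ι) (M : Matrix (V × ι) (V × ι) K) (N : Matrix V V K)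
    (hM : ∀ v w r, ∑ t, M (v, t) (w, r) = N v w) :
    M.det = N.det * (Matrix.of fun p q : V × {t : ι // t ≠ o} =>
      M (p.1, p.2.1) (q.1, q.2.1) - M (p.1, p.2.1) (q.1, o)).det := by
  let e := sheetEquiv V o
  let S : Matrix V (V × {t : ι // t ≠ o}) K := Matrix.of fun v p => if v = p.1 then 1 else 0
  let A := (M.submatrix e e).toBlocks₁₁
  let B := (M.submatrix e e).toBlocks₁₂
  let C := (M.submatrix e e).toBlocks₂₁
  let D := (M.submatrix e e).toBlocks₂₂
  have hsplit : ∀ f : ι → K, f o + ∑ t : {t : ι // t ≠ o}, f t = ∑ t, f t := fun f =>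
    Fintype.sum_eq_add_sum_subtype_ne f o |>.symm
  have hA : A + S * C = N := by
    ext v w
    rw [← hM v w o, ← hsplit]
    simp [A, S, C, e, sheetEquiv, Matrix.mul_apply, Fintype.sum_prod_type, Matrix.toBlocks₁₁,
      Matrix.toBlocks₂₁]
  have hB : B + S * D = N * S := by
    ext v ⟨w, r⟩
    have : (N * S) v (w, r) = N v w := by simp [S, Matrix.mul_apply]
    rw [this, ← hM v w r, ← hsplit]
    simp [B, S, D, e, sheetEquiv, Matrix.mul_apply, Fintype.sum_prod_type, Matrix.toBlocks₁₂,
      Matrix.toBlocks₂₂]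
  have hD : D - C * S = Matrix.of fun p q : V × {t : ι // t ≠ o} =>
      M (p.1, p.2.1) (q.1, q.2.1) - M (p.1, p.2.1) (q.1, o) := by
    ext p q
    simp [S, C, D, e, sheetEquiv, Matrix.mul_apply, Matrix.toBlocks₂₁, Matrix.toBlocks₂₂]
  -- Conjugating by a unipotent matrix adds up the sheets and makes `M` block triangular.
  have hconj : Matrix.fromBlocks 1 S 0 1 * M.submatrix e e * Matrix.fromBlocks 1 (-S) 0 1 =
      Matrix.fromBlocks N 0 C (D - C * S) := by
    rw [← Matrix.fromBlocks_toBlocks (M.submatrix e e)]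
    change Matrix.fromBlocks 1 S 0 1 * Matrix.fromBlocks A B C D * Matrix.fromBlocks 1 (-S) 0 1 = _
    rw [Matrix.fromBlocks_multiply, Matrix.fromBlocks_multiply]
    simp [hA, hB, sub_eq_neg_add]
  have hdet := congrArg Matrix.det hconj
  rw [Matrix.det_mul, Matrix.det_mul, Matrix.det_fromBlocks_zero₂₁, Matrix.det_fromBlocks_zero₂₁,
    Matrix.det_fromBlocks_zero₁₂, Matrix.det_submatrix_equiv_self, hD] at hdet
  simpa using hdet

/-! ### The Laplacian of a cover -/

theorem edgeWeight_cover {V E K : Type*} [DecidableEq V] [Fintype E] [Field K] {k : ℕ}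
    (Γ : WeightedDigraph V E K) (σ : E → Equiv.Perm (Fin k)) (v w : V) (t r : Fin k) :
    (Γ.cover σ).edgeWeight (v, t) (w, r) =
      ∑ e with Γ.src e = v ∧ Γ.tgt e = w, if σ e t = r then Γ.wt e else 0 := by
  simp only [edgeWeight, cover, Finset.sum_filter, Fintype.sum_prod_type, Prod.mk.injEq]
  refine Finset.sum_congr rfl fun e _ => ?_
  rw [Finset.sum_eq_single t (fun x _ hx => by simp [hx]) (by simp)]
  split_ifs <;> simp_all

/-- Since voltages are permutations, the Laplacian of the cover induces the Laplacian of the base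
on fibre sums. -/
theorem sum_laplacian_cover {V E K : Type*} [DecidableEq V] [Fintype E] [Field K] {k : ℕ}
    (Γ : WeightedDigraph V E K) (σ : E → Equiv.Perm (Fin k)) (v w : V) (r : Fin k) :
    ∑ t, (Γ.cover σ).laplacian (v, t) (w, r) = Γ.laplacian v w := by
  simp only [laplacian, Matrix.sub_apply, Matrix.of_apply, Finset.sum_sub_distrib,
    edgeWeight_cover, Matrix.diagonal_apply, outWeight_cover, Prod.mk.injEq]
  congr 1
  · by_cases h : v = w <;> simp [h]
  · rw [Finset.sum_comm, edgeWeight]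
    refine Finset.sum_congr rfl fun e _ => ?_
    simp [← Equiv.eq_symm_apply]

theorem voltageLaplacian_apply {V E K : Type*} [DecidableEq V] [Fintype E] [Field K] {k : ℕ}
    [NeZero k] (Γ : WeightedDigraph V E K) (σ : E → Equiv.Perm (Fin k))
    (p q : V × {t : Fin k // t ≠ 0}) :
    Γ.voltageLaplacian σ p q = (Γ.cover σ).laplacian (p.1, p.2.1) (q.1, q.2.1) -
      (Γ.cover σ).laplacian (p.1, p.2.1) (q.1, 0) := by
  obtain ⟨v, t, ht⟩ := p
  obtain ⟨w, r, hr⟩ := q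
  simp only [voltageLaplacian, voltageDegree, voltageAdjacency, laplacian, Matrix.sub_apply,
    Matrix.of_apply, Matrix.diagonal_apply, outWeight_cover, Prod.mk.injEq, Subtype.mk.injEq, ht,
    and_false, if_false]
  ring

/-- The cofactor of the Laplacian of the cover at `(v, x)` factors through the zero fibre sum
functions and the quotient by them. The factor `1 / k` arises because the root is spread evenly over
the fibre of `v`. -/
theorem arborescenceSum_cover {V E K : Type*} [Fintype V] [DecidableEq V] [Fintype E]
    [Field K] [CharZero K] {k : ℕ} [NeZero k] (Γ : WeightedDigraph V E K)
    (σ : E → Equiv.Perm (Fin k)) (v : V) (x : Fin k) :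
    (Γ.cover σ).arborescenceSum (v, x) =
      1 / (k : K) * (Γ.voltageLaplacian σ).det * Γ.arborescenceSum v := by
  have : Nonempty V := ⟨v⟩
  have hk : (k : K) ≠ 0 := Nat.cast_ne_zero.2 (NeZero.ne k)
  let A := (Γ.cover σ).laplacian
  let z : V × Fin k → K := fun q => if q.1 = v then 1 / (k : K) else 0
  -- Row `(v, x)` may be replaced by the normalized indicator of the whole fibre of `v`.
  have h1 : (Γ.cover σ).arborescenceSum (v, x) = (A.updateRow (v, x) z).det := by
    rw [← det_laplacian_updateRow]
    refine det_updateRow_eq_of_sum_eq A (laplacian_mulVec_one _) _ ?_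
    simp [z, Fintype.sum_prod_type_right, hk]
  -- Adding back the old row, at no cost since `A` is singular, restores constant fibre sums.
  have h2 : (A.updateRow (v, x) z).det = (A.updateRow (v, x) (A (v, x) + z)).det := by
    rw [Matrix.det_updateRow_add, Matrix.updateRow_eq_self, det_laplacian, zero_add]
  have hB : ∀ p q, A.updateRow (v, x) (A (v, x) + z) p q =
      A p q + if p = (v, x) then z q else 0 := by
    intro p q
    by_cases hp : p = (v, x)
    · subst hp
      simp
    · simp [hp]
  let N : Matrix V V K :=
    Γ.laplacian.updateRow v (Γ.laplacian v + (1 / (k : K)) • Pi.single v 1)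
  have h3 : ∀ u w r, ∑ t, A.updateRow (v, x) (A (v, x) + z) (u, t) (w, r) = N u w := by
    intro u w r
    simp only [hB, Finset.sum_add_distrib, A, sum_laplacian_cover, Prod.mk.injEq]
    by_cases hu : u = v
    · subst hu
      simp [N, z, Pi.single_apply]
    · simp [N, hu]
  have hN : N.det = 1 / (k : K) * Γ.arborescenceSum v := by
    rw [Matrix.det_updateRow_add, Matrix.updateRow_eq_self, Matrix.det_updateRow_smul,
      det_laplacian_updateRow, det_laplacian, zero_add]
  have h4 : (Matrix.of fun p q : V × {t : Fin k // t ≠ 0} =>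
      A.updateRow (v, x) (A (v, x) + z) (p.1, p.2.1) (q.1, q.2.1) -
        A.updateRow (v, x) (A (v, x) + z) (p.1, p.2.1) (q.1, 0)) = Γ.voltageLaplacian σ := by
    ext p q
    rw [Matrix.of_apply, hB, hB, voltageLaplacian_apply]
    simp [A, z]
  rw [h1, h2, det_eq_mul_of_fiber_sum 0 _ N h3, h4, hN]
  ring

/-! ### The expected determinant -/

/-- A row of the matrix of a permutation of `Fin k` acting on the functions with zero sum, in the
basis `e_r - e_0`, `r ≠ 0`, placed in the columns over the vertex `w`. The row of `t` depends only
on the image `s` of `t`: it is the indicator of `s` if `s ≠ 0`, and constantly `-1` if `s = 0`. -/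
def standardRow (K : Type*) [Field K] (V : Type*) [DecidableEq V] {k : ℕ} [NeZero k] (w : V)
    (s : Fin k) : V × {t : Fin k // t ≠ 0} → K :=
  fun q => if q.1 = w then (if s = q.2.1 then 1 else 0) - (if s = 0 then 1 else 0) else 0

theorem sum_standardRow {K V : Type*} [Field K] [DecidableEq V] {k : ℕ} [NeZero k] (w : V) :
    ∑ s : Fin k, standardRow K V w s = 0 := by
  ext q
  by_cases h : q.1 = w <;> simp [standardRow, h, Finset.sum_apply, Finset.sum_sub_distrib]

/-- The summands of the rows of the voltage Laplacian: `none` stands for the diagonal entry, and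
`some e` for the edge `e`. -/
def rowTerm {V E K : Type*} [DecidableEq V] [Fintype E] [Field K] {k : ℕ} [NeZero k]
    (Γ : WeightedDigraph V E K) (σ : E → Equiv.Perm (Fin k)) (p : V × {t : Fin k // t ≠ 0}) :
    Option E → V × {t : Fin k // t ≠ 0} → K
  | none => Pi.single p (Γ.outWeight p.1)
  | some e => if Γ.src e = p.1 then -Γ.wt e • standardRow K V (Γ.tgt e) (σ e p.2.1) else 0

theorem voltageLaplacian_row {V E K : Type*} [DecidableEq V] [Fintype E] [Field K] {k : ℕ}
    [NeZero k] (Γ : WeightedDigraph V E K) (σ : E → Equiv.Perm (Fin k))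
    (p : V × {t : Fin k // t ≠ 0}) :
    Γ.voltageLaplacian σ p = ∑ j, Γ.rowTerm σ p j := by
  ext q
  have hdiag : Γ.rowTerm σ p none q = if p = q then Γ.outWeight p.1 else 0 := by
    simp [rowTerm, Pi.single_apply, eq_comm]
  have hedge : ∀ e, Γ.rowTerm σ p (some e) q =
      -(if Γ.src e = p.1 ∧ Γ.tgt e = q.1 then
        (if σ e p.2.1 = q.2.1 then Γ.wt e else 0) - if σ e p.2.1 = 0 then Γ.wt e else 0 else 0) := by
    intro e
    by_cases h1 : Γ.src e = p.1 <;> by_cases h2 : Γ.tgt e = q.1 <;>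
      simp [rowTerm, h1, h2, standardRow, eq_comm (a := q.1), mul_sub]
    split_ifs <;> ring
  rw [Finset.sum_apply, Fintype.sum_option, hdiag]
  simp only [hedge, voltageLaplacian, voltageDegree, voltageAdjacency, Matrix.sub_apply,
    Matrix.of_apply, Matrix.diagonal_apply, edgeWeight_cover, Finset.sum_neg_distrib,
    ← Finset.sum_filter, Finset.sum_sub_distrib, ← sub_eq_add_neg]

/-- The term of the row expansion of the determinant of the voltage Laplacian in which row `p` uses
the summand `j p`. -/
def expansionTerm {V E K : Type*} [Fintype V] [DecidableEq V] [Fintype E] [Field K] {k : ℕ}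
    [NeZero k] (Γ : WeightedDigraph V E K) (j : V × {t : Fin k // t ≠ 0} → Option E)
    (σ : E → Equiv.Perm (Fin k)) : K :=
  (Matrix.of fun p => Γ.rowTerm σ p (j p)).det

theorem det_voltageLaplacian {V E K : Type*} [Fintype V] [DecidableEq V] [Fintype E]
    [Field K] {k : ℕ} [NeZero k] (Γ : WeightedDigraph V E K)
    (σ : E → Equiv.Perm (Fin k)) :
    (Γ.voltageLaplacian σ).det = ∑ j, Γ.expansionTerm j σ := by
  classical
  have h : Γ.voltageLaplacian σ = fun p => ∑ j, Γ.rowTerm σ p j :=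
    funext (Γ.voltageLaplacian_row σ)
  rw [h]
  exact (Matrix.detRowAlternating (R := K)).toMultilinearMap.map_sum _

theorem expansionTerm_none {V E K : Type*} [Fintype V] [DecidableEq V] [Fintype E] [Field K]
    {k : ℕ} [NeZero k] (Γ : WeightedDigraph V E K) (σ : E → Equiv.Perm (Fin k)) :
    Γ.expansionTerm (fun _ => none) σ = (Γ.voltageDegree k).det := by
  unfold expansionTerm voltageDegree
  congr 1
  ext p q
  simp [rowTerm, Matrix.diagonal_apply, Pi.single_apply, eq_comm]

theorem expansionTerm_eq_zero {V E K : Type*} [Fintype V] [DecidableEq V] [Fintype E] [Field K]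
    {k : ℕ} [NeZero k] (Γ : WeightedDigraph V E K) {j : V × {t : Fin k // t ≠ 0} → Option E}
    {e : E} {p : V × {t : Fin k // t ≠ 0}} (hp : j p = some e) (hs : Γ.src e ≠ p.1)
    (σ : E → Equiv.Perm (Fin k)) : Γ.expansionTerm j σ = 0 :=
  Matrix.det_eq_zero_of_row_eq_zero p fun q => by simp [rowTerm, hp, hs]

/-- If two rows use the same edge `e`, composing `σ e` with a transposition exchanges the two rows,
so that the terms cancel in pairs. -/
theorem sum_expansionTerm_of_pair {V E K : Type*} [Fintype V] [DecidableEq V] [Fintype E]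
    [DecidableEq E] [Field K] [CharZero K] {k : ℕ} [NeZero k] (Γ : WeightedDigraph V E K)
    (j : V × {t : Fin k // t ≠ 0} → Option E) (e : E) {p p' : V × {t : Fin k // t ≠ 0}}
    (hpp' : p ≠ p') (hp : j p = some e) (hp' : j p' = some e)
    (hs : Γ.src e = p.1) (hs' : Γ.src e = p'.1) :
    ∑ σ, Γ.expansionTerm j σ = 0 := by
  have hneg : ∀ σ, Γ.expansionTerm j (σ * Pi.mulSingle e (Equiv.swap p.2.1 p'.2.1)) =
      -Γ.expansionTerm j σ := by
    intro σ
    have hdet := Matrix.det_permute (Equiv.swap p p') (Matrix.of fun p => Γ.rowTerm σ p (j p))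
    rw [Equiv.Perm.sign_swap hpp'] at hdet
    simp only [Units.val_neg, Units.val_one, Int.cast_neg, Int.cast_one, neg_mul, one_mul] at hdet
    rw [expansionTerm, expansionTerm, ← hdet]
    refine congrArg Matrix.det (funext fun q => ?_)
    change Γ.rowTerm _ q (j q) = Γ.rowTerm σ (Equiv.swap p p' q) (j (Equiv.swap p p' q))
    by_cases hqp : q = p
    · subst hqp
      simp [rowTerm, hp, hp', hs, ← hs']
    by_cases hqp' : q = p'
    · subst hqp'
      simp [rowTerm, hp, hp', hs', ← hs]
    rw [Equiv.swap_apply_of_ne_of_ne hqp hqp']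
    rcases hq : j q with _ | e'
    · rfl
    by_cases he : e' = e
    · subst he
      by_cases hsq : Γ.src e' = q.1
      · -- The transposition fixes the sheets of the remaining rows in this fibre.
        have h1 : q.2.1 ≠ p.2.1 := fun h =>
          hqp (Prod.ext (hsq.symm.trans hs) (Subtype.ext h))
        have h2 : q.2.1 ≠ p'.2.1 := fun h =>
          hqp' (Prod.ext (hsq.symm.trans hs') (Subtype.ext h))
        simp [rowTerm, Equiv.swap_apply_of_ne_of_ne h1 h2]
      · simp [rowTerm, hsq]
    · simp [rowTerm, Pi.mulSingle_eq_of_ne he]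
  have h := Equiv.sum_comp (Equiv.mulRight (Pi.mulSingle e (Equiv.swap p.2.1 p'.2.1)))
    (Γ.expansionTerm j)
  simp only [Equiv.coe_mulRight, hneg, Finset.sum_neg_distrib] at h
  exact neg_eq_self.1 h

/-- If exactly one row uses the edge `e`, averaging over the rotations of `σ e` replaces this row
by zero. -/
theorem sum_expansionTerm_of_unique {V E K : Type*} [Fintype V] [DecidableEq V] [Fintype E]
    [DecidableEq E] [Field K] [CharZero K] {k : ℕ} [NeZero k] (Γ : WeightedDigraph V E K)
    (j : V × {t : Fin k // t ≠ 0} → Option E) (e : E) {p : V × {t : Fin k // t ≠ 0}}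
    (hp : j p = some e) (huniq : ∀ q, j q = some e → q = p) :
    ∑ σ, Γ.expansionTerm j σ = 0 := by
  let μ : Fin k → E → Equiv.Perm (Fin k) := fun s => Pi.mulSingle e (Equiv.addRight s)
  have hμ : ∀ s, μ s e = Equiv.addRight s := fun s => Pi.mulSingle_eq_same e _
  have hrot : ∀ σ, ∑ s : Fin k,
      Γ.expansionTerm j (μ s * σ) = 0 := by
    intro σ
    let M := Matrix.of fun p => Γ.rowTerm σ p (j p)
    have hM : ∀ s : Fin k, Γ.expansionTerm j (μ s * σ) =
        (M.updateRow p
          (Γ.rowTerm (μ s * σ) p (some e))).det := by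
      intro s
      rw [expansionTerm]
      refine congrArg Matrix.det (funext fun q => ?_)
      change Γ.rowTerm _ q (j q) = _
      by_cases hq : q = p
      · subst hq
        rw [Matrix.updateRow_self, hp]
      · rw [Matrix.updateRow_ne hq]
        change _ = Γ.rowTerm σ q (j q)
        rcases hj : j q with _ | e'
        · rfl
        · have he : e' ≠ e := fun h => hq (huniq q (h ▸ hj))
          simp [rowTerm, μ, Pi.mulSingle_eq_of_ne he]
    have hsum : ∑ s : Fin k,
        Γ.rowTerm (μ s * σ) p (some e) = 0 := by
      by_cases hs : Γ.src e = p.1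
      · simp only [rowTerm, hs, if_true, Pi.mul_apply, hμ, Equiv.Perm.mul_apply,
          Equiv.coe_addRight, ← Finset.smul_sum]
        have h0 : ∑ s, standardRow K V (Γ.tgt e) (σ e p.2.1 + s) = 0 :=
          (Equiv.sum_comp (Equiv.addLeft (σ e p.2.1)) _).trans (sum_standardRow _)
        rw [h0, smul_zero]
      · simp [rowTerm, hs]
    simp only [hM]
    refine ((Matrix.detRowAlternating (R := K)).toMultilinearMap.map_update_sum
      Finset.univ p _ M).symm.trans ?_
    rw [hsum]
    exact (Matrix.detRowAlternating (R := K)).toMultilinearMap.map_update_zero M p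
  have hshift : ∀ s : Fin k, ∑ σ, Γ.expansionTerm j (μ s * σ) =
      ∑ σ, Γ.expansionTerm j σ := fun s =>
    Equiv.sum_comp (Equiv.mulLeft (μ s)) (Γ.expansionTerm j)
  have h : (k : K) * ∑ σ, Γ.expansionTerm j σ = 0 := by
    calc (k : K) * ∑ σ, Γ.expansionTerm j σ
        = ∑ s : Fin k, ∑ σ, Γ.expansionTerm j (μ s * σ) := by
          simp [hshift]
      _ = 0 := by
          rw [Finset.sum_comm]
          exact Finset.sum_eq_zero fun σ _ => hrot σ
  exact (mul_eq_zero.1 h).resolve_left (Nat.cast_ne_zero.2 (NeZero.ne k))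

theorem sum_expansionTerm_of_ne_none {V E K : Type*} [Fintype V] [DecidableEq V] [Fintype E]
    [DecidableEq E] [Field K] [CharZero K] {k : ℕ} [NeZero k] (Γ : WeightedDigraph V E K)
    {j : V × {t : Fin k // t ≠ 0} → Option E} (hj : j ≠ fun _ => none) :
    ∑ σ, Γ.expansionTerm j σ = 0 := by
  obtain ⟨p, hp⟩ := Function.ne_iff.1 hj
  obtain ⟨e, hp⟩ := Option.ne_none_iff_exists'.1 hp
  by_cases huniq : ∀ q, j q = some e → q = p
  · exact Γ.sum_expansionTerm_of_unique j e hp huniq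
  push Not at huniq
  obtain ⟨p', hp', hne⟩ := huniq
  by_cases hs : Γ.src e = p.1
  · by_cases hs' : Γ.src e = p'.1
    · exact Γ.sum_expansionTerm_of_pair j e hne.symm hp hp' hs hs'
    · exact Finset.sum_eq_zero fun σ _ => Γ.expansionTerm_eq_zero hp' hs' σ
  · exact Finset.sum_eq_zero fun σ _ => Γ.expansionTerm_eq_zero hp hs σ

theorem voltageExpectation_det_voltageLaplacian {V E K : Type*} [Fintype V] [DecidableEq V]
    [Fintype E] [DecidableEq E] [Field K] [CharZero K] {k : ℕ} [NeZero k]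
    (Γ : WeightedDigraph V E K) :
    voltageExpectation (fun σ : E → Equiv.Perm (Fin k) => (Γ.voltageLaplacian σ).det) =
      (Γ.voltageDegree k).det := by
  classical
  simp only [voltageExpectation, det_voltageLaplacian]
  rw [Finset.expect_sum_comm, Finset.sum_eq_single fun _ => none]
  · simp only [expansionTerm_none]
    exact Fintype.expect_const _
  · intro j _ hj
    rw [Finset.expect, Γ.sum_expansionTerm_of_ne_none hj, smul_zero]
  · simp

theorem det_voltageDegree {V E K : Type*} [Fintype V] [DecidableEq V] [Fintype E] [Field K]
    (Γ : WeightedDigraph V E K) (k : ℕ) [NeZero k] :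
    (Γ.voltageDegree k).det = ∏ w, Γ.outWeight w ^ (k - 1) := by
  rw [voltageDegree, Matrix.det_diagonal, Fintype.prod_prod_type]
  simp [Fintype.card_subtype_compl]

end WeightedDigraph

theorem theorem1p1 {V E K : Type*} [Fintype V] [DecidableEq V] [Fintype E] [DecidableEq E]
    [Field K] [CharZero K] (Γ : WeightedDigraph V E K) (k : ℕ) [NeZero k] :
    -- the expected arborescence ratio, at every root where the ratio makes sense
    (∀ (v : V) (x : Fin k), Γ.arborescenceSum v ≠ 0 →
      WeightedDigraph.voltageExpectation
          (fun σ : E → Equiv.Perm (Fin k) => Γ.arborescenceRatio σ v x) =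
        1 / (k : K) * ∏ w : V, Γ.outWeight w ^ (k - 1)) ∧
    -- for fixed voltages, the ratio is `det 𝓛 / k`; in particular it depends neither on the root
    -- nor on its lift
    (∀ (σ : E → Equiv.Perm (Fin k)) (v : V) (x : Fin k), Γ.arborescenceSum v ≠ 0 →
      Γ.arborescenceRatio σ v x = 1 / (k : K) * (Γ.voltageLaplacian σ).det) ∧
    -- the expected determinant of `D - 𝓐`
    WeightedDigraph.voltageExpectation
        (fun σ : E → Equiv.Perm (Fin k) => (Γ.voltageDegree k - Γ.voltageAdjacency σ).det) =
      (Γ.voltageDegree k).det := by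
  have hratio : ∀ (σ : E → Equiv.Perm (Fin k)) (v : V) (x : Fin k), Γ.arborescenceSum v ≠ 0 →
      Γ.arborescenceRatio σ v x = 1 / (k : K) * (Γ.voltageLaplacian σ).det := fun σ v x hv => by
    rw [WeightedDigraph.arborescenceRatio, Γ.arborescenceSum_cover, mul_div_cancel_right₀ _ hv]
  refine ⟨fun v x hv => ?_, hratio, Γ.voltageExpectation_det_voltageLaplacian⟩
  simp only [hratio _ v x hv]
  rw [← Γ.det_voltageDegree, ← Γ.voltageExpectation_det_voltageLaplacian]
  exact (Finset.mul_expect _ _ _).symm
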